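/- Let $\Omega$ be a compact metric space, $T:\Omega\to\Omega$ a homeomorphism, and let $a:\Omega\to\mathbb C$ and $b:\Omega\to\mathbb R$ be continuous functions. For each $\omega\in\Omega$ let $J_\omega$ be the bounded (Jacobi) operator on $\ell^2(\mathbb Z,\mathbb C)$ given by $$(J_\omega\psi)(n)=\overline{a(T^{n-1}\omega)}\,\psi(n-1)+a(T^n\omega)\,\psi(n+1)+b(T^n\omega)\,\psi(n),\qquad n\in\mathbb Z,$$ and let $\rho(J_\omega)$ denote its resolvent set, that is, the set of all $E\in\mathbb C$ such that $J_\omega-E$ has a bounded inverse. For $E\in\mathbb C$ define the Jacobi cocycle map $B^E:\Omega\to \mathrm M(2,\mathbb C)$ by $$B^E(\omega)=\begin{pmatrix}E-b(\omega) & -\overline{a(T^{-1}\omega)}\\ a(\omega)&0\end{pmatrix}.$$ For a continuous map $B:\Omega\to \mathrm M(2,\mathbb C)$, put $B_n(\omega)=B(T^{n-1}\omega)\cdots B(\omega)$ for $n\ge 1$. Identify $\mathbb{CP}^1=\mathbb C\cup\{\infty\}$ (the Riemann sphere) with the set of one-dimensional subspaces of $\mathbb C^2$, where $z\in\mathbb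 C$ corresponds to the span of $\binom1z$ and $\infty$ to the span of $\binom01$. We say that $(T,B)$ has dominated splitting if there are continuous maps $E^s,E^u:\Omega\to\mathbb{CP}^1$ such that 1. $B(\omega)[E^s(\omega)]\subseteq E^s(T\omega)$ and $B(\omega)[E^u(\omega)]\subseteq E^u(T\omega)$ for all $\omega\in\Omega$; 2. there are an integer $N\ge1$ and a real number $\lambda>1$ such that $\|B_N(\omega)\vec u\|>\lambda\|B_N(\omega)\vec s\|$ for all $\omega\in\Omega$ and all unit vectors $\vec u\in E^u(\omega)$ and $\vec s\in E^s(\omega)$, where $\|\cdot\|$ is the Euclidean norm on $\mathbb C^2$. If $E\in\mathbb C$ is such that $(T,B^E)$ has dominated splitting, then $E\in\bigcap_{\omega\in\Omega}\rho(J_\omega)$. -/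

import Mathlib

open scoped lp ComplexConjugate

noncomputable section

namespace JacobiDS

/-! ### Jacobi operators on `ℓ²(ℤ, ℂ)` -/

/-- A bounded weighted shift of a square-summable sequence is square-summable, with the obvious
norm bound. -/
theorem weightedShift_aux (w : ℤ → ℂ) (K : ℝ) (hw : ∀ n, ‖w n‖ ≤ K) (k : ℤ)
    (ψ : ℓ²(ℤ, ℂ)) :
    ∃ h : Memℓp (fun n : ℤ => w n * ψ (n + k)) 2,
      ‖(⟨fun n : ℤ => w n * ψ (n + k), h⟩ : ℓ²(ℤ, ℂ))‖ ≤ K * ‖ψ‖ := by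
  have h2 : 0 < (2 : ENNReal).toReal := by norm_num
  have hK : 0 ≤ K := (norm_nonneg _).trans (hw 0)
  have hs := (lp.hasSum_norm h2 ψ)
  have hs' : HasSum (fun n : ℤ => ‖ψ (n + k)‖ ^ (2 : ENNReal).toReal)
      (‖ψ‖ ^ (2 : ENNReal).toReal) :=
    (Equiv.addRight k).hasSum_iff.mpr hs
  have hle : ∀ n : ℤ, ‖w n * ψ (n + k)‖ ^ (2 : ENNReal).toReal ≤
      K ^ (2 : ENNReal).toReal * ‖ψ (n + k)‖ ^ (2 : ENNReal).toReal := by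
    intro n
    rw [← Real.mul_rpow hK (norm_nonneg _), norm_mul]
    gcongr
    exact hw n
  have hm : Memℓp (fun n : ℤ => w n * ψ (n + k)) 2 :=
    memℓp_gen (Summable.of_nonneg_of_le (fun n => by positivity) hle
      (hs'.summable.mul_left _))
  refine ⟨hm, ?_⟩
  refine lp.norm_le_of_tsum_le h2 (by positivity) ?_
  rw [Real.mul_rpow hK (norm_nonneg _), ← (hs'.mul_left (K ^ (2 : ENNReal).toReal)).tsum_eq]
  exact (Summable.of_nonneg_of_le (fun n => by positivity) hle
    (hs'.summable.mul_left _)).tsum_le_tsum hle (hs'.summable.mul_left _)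

/-- The bounded operator `(W ψ)(n) = w n * ψ (n + k)` on `ℓ²(ℤ)`, for a bounded weight `w`. -/
def weightedShift (w : ℤ → ℂ) (K : ℝ) (hw : ∀ n, ‖w n‖ ≤ K) (k : ℤ) :
    ℓ²(ℤ, ℂ) →L[ℂ] ℓ²(ℤ, ℂ) :=
  LinearMap.mkContinuous
    { toFun := fun ψ => ⟨fun n : ℤ => w n * ψ (n + k), (weightedShift_aux w K hw k ψ).1⟩
      map_add' := fun ψ φ => by
        ext n
        exact mul_add _ _ _
      map_smul' := fun c ψ => by
        ext n
        simp [mul_left_comm] }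
    K (fun ψ => (weightedShift_aux w K hw k ψ).2)

theorem weightedShift_apply (w : ℤ → ℂ) (K : ℝ) (hw : ∀ n, ‖w n‖ ≤ K) (k : ℤ)
    (ψ : ℓ²(ℤ, ℂ)) (n : ℤ) : weightedShift w K hw k ψ n = w n * ψ (n + k) := rfl

/-- The dynamically defined Jacobi operator `J_ω`, as a bounded operator on `ℓ²(ℤ)`; its defining
formula is `jacobiOperator_apply` below. -/
def jacobiOperator {Ω : Type*} [MetricSpace Ω] [CompactSpace Ω] (T : Ω ≃ₜ Ω)
    (a : C(Ω, ℂ)) (b : C(Ω, ℝ)) (ω : Ω) : ℓ²(ℤ, ℂ) →L[ℂ] ℓ²(ℤ, ℂ) :=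
  weightedShift (fun n => conj (a ((T ^ (n - 1)) ω))) ‖a‖
      (fun n => by simpa using a.norm_coe_le_norm ((T ^ (n - 1)) ω)) (-1)
    + weightedShift (fun n => a ((T ^ n) ω)) ‖a‖ (fun n => a.norm_coe_le_norm ((T ^ n) ω)) 1
    + weightedShift (fun n => (b ((T ^ n) ω) : ℂ)) ‖b‖
      (fun n => by simpa using b.norm_coe_le_norm ((T ^ n) ω)) 0

theorem jacobiOperator_apply {Ω : Type*} [MetricSpace Ω] [CompactSpace Ω] (T : Ω ≃ₜ Ω)
    (a : C(Ω, ℂ)) (b : C(Ω, ℝ)) (ω : Ω) (ψ : ℓ²(ℤ, ℂ)) (n : ℤ) :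
    jacobiOperator T a b ω ψ n =
      conj (a ((T ^ (n - 1)) ω)) * ψ (n - 1) + a ((T ^ n) ω) * ψ (n + 1)
        + (b ((T ^ n) ω) : ℂ) * ψ n := by
  simp [jacobiOperator, weightedShift_apply, sub_eq_add_neg]

/-! ### Cocycles and dominated splitting -/

/-- The Jacobi cocycle map `B^E : Ω → M(2, ℂ)` at energy `E`. -/
def jacobiCocycle {Ω : Type*} [MetricSpace Ω] (T : Ω ≃ₜ Ω)
    (a : C(Ω, ℂ)) (b : C(Ω, ℝ)) (E : ℂ) : C(Ω, Matrix (Fin 2) (Fin 2) ℂ) where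
  toFun ω := !![E - (b ω : ℂ), -conj (a (T⁻¹ ω)); a ω, 0]
  continuous_toFun := by
    have hT : Continuous (fun ω => T⁻¹ ω) := (T⁻¹).continuous
    refine continuous_matrix fun i j => ?_
    fin_cases i <;> fin_cases j <;> simp <;> fun_prop

/-- The iterates `B_n(ω) = B(T^{n-1} ω) ⋯ B(ω)`, `B_0(ω) = I`. -/
def cocycleIter {Ω : Type*} [MetricSpace Ω] (T : Ω ≃ₜ Ω)
    (B : C(Ω, Matrix (Fin 2) (Fin 2) ℂ)) : ℕ → Ω → Matrix (Fin 2) (Fin 2) ℂ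
  | 0, _ => 1
  | n + 1, ω => B ((T ^ n) ω) * cocycleIter T B n ω

/-- The one-dimensional subspace of `ℂ²` (with its Euclidean norm) that corresponds to a point of
the Riemann sphere `ℂℙ¹ = ℂ ∪ {∞}`: `z` is the line spanned by `(1, z)`, and `∞` the line spanned
by `(0, 1)`. -/
def line : OnePoint ℂ → Submodule ℂ (EuclideanSpace ℂ (Fin 2))
  | some z => Submodule.span ℂ {!₂[1, z]}
  | none => Submodule.span ℂ {!₂[0, 1]}

/-- Dominated splitting of the cocycle `(T, B)`: there are continuous, `B`-invariant fields of
lines `Es`, `Eu` such that some iterate of `B` expands `Eu` uniformly more than `Es`. The topology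
on `ℂℙ¹` is that of the Riemann sphere, the one-point compactification of `ℂ`. -/
def DominatedSplitting {Ω : Type*} [MetricSpace Ω] (T : Ω ≃ₜ Ω)
    (B : C(Ω, Matrix (Fin 2) (Fin 2) ℂ)) : Prop :=
  ∃ Es Eu : C(Ω, OnePoint ℂ),
    (∀ ω, (line (Es ω)).map (Matrix.toEuclideanLin (B ω)) ≤ line (Es (T ω)) ∧
      (line (Eu ω)).map (Matrix.toEuclideanLin (B ω)) ≤ line (Eu (T ω))) ∧
    ∃ N : ℕ, 0 < N ∧ ∃ lam : ℝ, 1 < lam ∧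
      ∀ ω, ∀ u ∈ line (Eu ω), ∀ s ∈ line (Es ω), ‖u‖ = 1 → ‖s‖ = 1 →
        lam * ‖Matrix.toEuclideanLin (cocycleIter T B N ω) s‖ <
          ‖Matrix.toEuclideanLin (cocycleIter T B N ω) u‖

end JacobiDS

end

namespace JacobiDS

/-! ### Scalar recursions with dominated coefficients -/

/-! It suffices to bound `‖φ‖` by a multiple of `‖(E - J_ω) φ‖`: the spectrum of the self-adjoint
`J_ω` is real, and a self-adjoint operator bounded below is invertible
(`mem_resolventSet_of_bound`).

If `(E - J_ω) φ = f`, the cocycle sends `(φ n, φ (n-1))` to `a n • (φ (n+1), φ n) + (f n, 0)`. In a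
frame of unit vectors from the two invariant lines, with multipliers `μ` (dominating) and `σ`
(dominated), the coordinates decouple: one is controlled by its successor, the other by its
predecessor, both with coefficients `|a| / |μ|` up to determinant ratios
(`DominatedFrame.exists_tsum_sq_le`).

Since the cocycle has determinant `a n * conj (a (n-1))`, products of `|μ σ|` match products of
`|a|²` up to boundary factors, while domination makes products of `|σ|` exponentially smaller than
those of `|μ|`. Hence products of `|a| / |μ|` decay exponentially, even where `a` vanishes
(`DominatedData.exists_prod_div_sq_le`). Iterating and summing gives the `ℓ²` bound
(`DominatedData.exists_tsum_sq_le`). Compactness of `Ω` makes the constants uniform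
(`DominatedSplitting.exists_frame`). -/

theorem exists_prod_le_geometric {m s : ℤ → ℝ} {c S lam : ℝ} {N : ℕ} (hc : 0 < c)
    (hm : ∀ n, c ≤ m n) (hs : ∀ n, 0 ≤ s n) (hS : ∀ n, s n ≤ S) (hN : 0 < N) (hlam : 1 < lam)
    (hdom : ∀ n : ℤ, lam * ∏ j ∈ Finset.range N, s (n + j) ≤ ∏ j ∈ Finset.range N, m (n + j)) :
    ∃ τ C : ℝ, 0 < τ ∧ τ < 1 ∧ 0 < C ∧ ∀ (k : ℕ) (n : ℤ),
      ∏ j ∈ Finset.range k, s (n + j) ≤ C * τ ^ k * ∏ j ∈ Finset.range k, m (n + j) := by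
  have hm0 : ∀ n, 0 < m n := fun n => hc.trans_le (hm n)
  obtain ⟨τ, hτ0, hτ1, hτN⟩ : ∃ τ : ℝ, 0 < τ ∧ τ < 1 ∧ τ ^ N = lam⁻¹ := by
    have hl : 0 < lam := by linarith
    refine ⟨(lam⁻¹) ^ ((N : ℝ)⁻¹), by positivity, ?_, Real.rpow_inv_natCast_pow (by positivity) hN.ne'⟩
    exact Real.rpow_lt_one (by positivity) (inv_lt_one_of_one_lt₀ hlam) (by positivity)
  -- `R * τ` bounds every ratio `s / m`, and `R ≥ 1` lets `R ^ N` cover any product of fewer than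
  -- `N` factors. Longer products shed blocks of `N`, each costing exactly `τ ^ N`.
  set R : ℝ := max 1 (S / (c * τ)) with hR
  have hR1 : 1 ≤ R := le_max_left _ _
  have hsm : ∀ n, s n ≤ (R * τ) * m n := by
    intro n
    have h1 : S / (c * τ) ≤ R := le_max_right _ _
    rw [div_le_iff₀ (by positivity)] at h1
    calc s n ≤ S := hS n
      _ ≤ R * τ * c := by linarith
      _ ≤ R * τ * m n := by gcongr; exact hm n
  refine ⟨τ, R ^ N, hτ0, hτ1, by positivity, ?_⟩
  intro k
  induction k using Nat.strong_induction_on with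
  | _ k ih =>
    intro n
    have hp : ∀ (l : ℕ) (i : ℤ), 0 < ∏ j ∈ Finset.range l, m (i + j) :=
      fun l i => Finset.prod_pos fun j _ => hm0 _
    by_cases hk : k < N
    · calc ∏ j ∈ Finset.range k, s (n + j)
          ≤ ∏ j ∈ Finset.range k, (R * τ) * m (n + j) :=
            Finset.prod_le_prod (fun j _ => hs _) (fun j _ => hsm _)
        _ = R ^ k * τ ^ k * ∏ j ∈ Finset.range k, m (n + j) := by
            rw [Finset.prod_mul_distrib, Finset.prod_const, Finset.card_range, mul_pow]
        _ ≤ R ^ N * τ ^ k * ∏ j ∈ Finset.range k, m (n + j) := by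
            have := hp k n
            gcongr
    · obtain ⟨l, rfl⟩ : ∃ l, k = N + l := ⟨k - N, by omega⟩
      have h1 := ih l (by omega) (n + N)
      have h2 : ∏ j ∈ Finset.range N, s (n + j) ≤ τ ^ N * ∏ j ∈ Finset.range N, m (n + j) := by
        rw [hτN, inv_mul_eq_div, le_div_iff₀ (by linarith), mul_comm]
        exact hdom n
      have key : ∀ g : ℤ → ℝ, ∏ j ∈ Finset.range (N + l), g (n + j) =
          (∏ j ∈ Finset.range N, g (n + j)) * ∏ j ∈ Finset.range l, g (n + N + j) := by
        intro g
        rw [Finset.prod_range_add]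
        congr 1
        refine Finset.prod_congr rfl fun j _ => ?_
        push_cast
        rw [add_assoc]
      rw [key, key]
      calc _ ≤ (τ ^ N * ∏ j ∈ Finset.range N, m (n + j)) *
            (R ^ N * τ ^ l * ∏ j ∈ Finset.range l, m (n + N + j)) := by
            refine mul_le_mul h2 h1 (Finset.prod_nonneg fun j _ => hs _) ?_
            have := hp N n
            positivity
        _ = _ := by ring

/-- Scalar data of a dominated splitting along an orbit: `m` and `s` are the multipliers in the
dominating and the dominated direction, `x` the off-diagonal coefficients of the operator, and `d`
the density in the determinant identity. -/
structure DominatedData (x m s d : ℤ → ℝ) : Prop where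
  x_nonneg : ∀ n, 0 ≤ x n
  s_nonneg : ∀ n, 0 ≤ s n
  exists_x_le : ∃ A, ∀ n, x n ≤ A
  exists_le_m : ∃ c > 0, ∀ n, c ≤ m n
  exists_le_d : ∃ c > 0, ∀ n, c ≤ d n
  exists_d_le : ∃ A, ∀ n, d n ≤ A
  det_eq : ∀ n, m n * s n * d (n + 1) = x n * x (n - 1) * d n
  dominated : ∃ N : ℕ, 0 < N ∧ ∃ lam : ℝ, 1 < lam ∧ ∀ n : ℤ,
    lam * ∏ j ∈ Finset.range N, s (n + j) ≤ ∏ j ∈ Finset.range N, m (n + j)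

/-- Telescoping of `det_eq`: each interior `x` occurs twice, and the factor `x (n + k - 1)` on the
left completes the square. -/
theorem DominatedData.prod_mul_eq {x m s d : ℤ → ℝ} (h : DominatedData x m s d) (n : ℤ) (k : ℕ) :
    (∏ j ∈ Finset.range k, m (n + j)) * (∏ j ∈ Finset.range k, s (n + j)) *
      (d (n + k) * x (n + k - 1)) =
    (∏ j ∈ Finset.range k, x (n + j)) ^ 2 * (d n * x (n - 1)) := by
  induction k with
  | zero => simp
  | succ k ih =>
    rw [Finset.prod_range_succ, Finset.prod_range_succ, Finset.prod_range_succ]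
    have h1 := h.det_eq (n + k)
    have e1 : n + ((k + 1 : ℕ) : ℤ) = n + k + 1 := by push_cast; ring
    rw [e1, add_sub_cancel_right]
    linear_combination (∏ j ∈ Finset.range k, m (n + j)) * (∏ j ∈ Finset.range k, s (n + j)) *
      x (n + k) * h1 + x (n + k) ^ 2 * ih

/-- `prod_mul_eq` turns domination into exponential decay, but only when the boundary factor `x (n -
1)` is not small. A small `x n` is harmless for another reason: its own ratio `x n / m n` is then at
most `1 / 2`. -/
theorem DominatedData.exists_prod_div_sq_le {x m s d : ℤ → ℝ} (h : DominatedData x m s d) :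
    ∃ K : ℕ, ∀ n : ℤ, (∏ j ∈ Finset.range K, x (n + j) / m (n + j)) ^ 2 ≤ 1 / 4 := by
  obtain ⟨A, hA⟩ := h.exists_x_le
  obtain ⟨c, hc, hcm⟩ := h.exists_le_m
  obtain ⟨δ, hδ, hδd⟩ := h.exists_le_d
  obtain ⟨Δ, hΔ⟩ := h.exists_d_le
  obtain ⟨N, hN, lam, hlam, hdom⟩ := h.dominated
  have hm0 : ∀ n, 0 < m n := fun n => hc.trans_le (hcm n)
  have hd0 : ∀ n, 0 < d n := fun n => hδ.trans_le (hδd n)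
  have hA0 : 0 ≤ A := (h.x_nonneg 0).trans (hA 0)
  have hΔ0 : 0 < Δ := (hd0 0).trans_le (hΔ 0)
  have hS : ∀ n, s n ≤ A * A * Δ / (c * δ) := by
    intro n
    rw [le_div_iff₀ (by positivity)]
    calc s n * (c * δ) ≤ s n * (m n * d (n + 1)) := by
          have := h.s_nonneg n
          have := hm0 n
          gcongr
          · exact hcm n
          · exact hδd _
      _ = x n * x (n - 1) * d n := by rw [← h.det_eq]; ring
      _ ≤ A * A * Δ := by
          have := hd0 n
          have := h.x_nonneg n
          have := h.x_nonneg (n - 1)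
          gcongr
          · exact hA n
          · exact hA _
          · exact hΔ n
  obtain ⟨τ, C, hτ0, hτ1, hC, hτ⟩ :=
    exists_prod_le_geometric hc hcm h.s_nonneg hS hN hlam hdom
  -- The floor `1 / 4` is the squared ratio gained at a site with `x n < c / 2`.
  set ρ : ℝ := max (1 / 4) τ with hρ
  have hρ4 : 1 / 4 ≤ ρ := le_max_left _ _
  have hρ0 : 0 < ρ := by linarith
  have hρτ : τ ≤ ρ := le_max_right _ _
  have hρ1 : ρ < 1 := max_lt (by norm_num) hτ1
  set C₁ : ℝ := C * (Δ * A) / (δ * (c / 2)) with hC₁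
  have hC₁0 : 0 ≤ C₁ := by positivity
  have big : ∀ (k : ℕ) (n : ℤ), c / 2 ≤ x (n - 1) →
      (∏ j ∈ Finset.range k, x (n + j) / m (n + j)) ^ 2 ≤ C₁ * ρ ^ k := by
    intro k n hx
    have hM : 0 < ∏ j ∈ Finset.range k, m (n + j) := Finset.prod_pos fun j _ => hm0 _
    have hSk : 0 ≤ ∏ j ∈ Finset.range k, s (n + j) := Finset.prod_nonneg fun j _ => h.s_nonneg _
    have h1 := h.prod_mul_eq n k
    have h2 := hτ k n
    rw [Finset.prod_div_distrib, div_pow, div_le_iff₀ (by positivity), hC₁, div_mul_eq_mul_div,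
      div_mul_eq_mul_div, le_div_iff₀ (by positivity)]
    set M := ∏ j ∈ Finset.range k, m (n + j)
    set P := ∏ j ∈ Finset.range k, x (n + j)
    set Q := ∏ j ∈ Finset.range k, s (n + j)
    calc P ^ 2 * (δ * (c / 2)) ≤ P ^ 2 * (d n * x (n - 1)) := by
          have := hd0 n
          gcongr
          exact hδd n
      _ = M * Q * (d (n + k) * x (n + k - 1)) := h1.symm
      _ ≤ M * (C * τ ^ k * M) * (Δ * A) := by
          have := hd0 (n + k)
          have := h.x_nonneg (n + k - 1)
          gcongr
          · exact hΔ _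
          · exact hA _
      _ ≤ M * (C * ρ ^ k * M) * (Δ * A) := by gcongr
      _ = C * (Δ * A) * ρ ^ k * M ^ 2 := by ring
  -- `1` serves the empty product; the other term serves a step with `c / 2 ≤ x n`.
  set C₂ : ℝ := max 1 ((A / c) ^ 2 * C₁ / ρ) with hC₂
  have all : ∀ (k : ℕ) (n : ℤ),
      (∏ j ∈ Finset.range k, x (n + j) / m (n + j)) ^ 2 ≤ C₂ * ρ ^ k := by
    intro k
    induction k with
    | zero => intro n; simp [hC₂]
    | succ k ih =>
      intro n
      have e : ∏ j ∈ Finset.range (k + 1), x (n + j) / m (n + j) =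
          (∏ j ∈ Finset.range k, x (n + 1 + j) / m (n + 1 + j)) * (x n / m n) := by
        rw [Finset.prod_range_succ']
        simp only [Nat.cast_add, Nat.cast_one, Nat.cast_zero, add_zero]
        congr 1
        refine Finset.prod_congr rfl fun j _ => ?_
        rw [add_right_comm, add_assoc n]
      rw [e, mul_pow]
      have hx0 := h.x_nonneg n
      have hmn := hm0 n
      by_cases hx : c / 2 ≤ x n
      -- After the first ratio is split off, `x n` is the boundary factor of the remaining product.
      · have h1 := big k (n + 1) (by simpa using hx)
        have h2 : x n / m n ≤ A / c := by
          gcongr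
          · exact hA n
          · exact hcm n
        calc _ ≤ C₁ * ρ ^ k * (A / c) ^ 2 := by gcongr
          _ = (A / c) ^ 2 * C₁ / ρ * ρ ^ (k + 1) := by field_simp; ring
          _ ≤ C₂ * ρ ^ (k + 1) := by gcongr; exact le_max_right _ _
      · push Not at hx
        have h2 : x n / m n ≤ 1 / 2 := by
          rw [div_le_iff₀ hmn]
          linarith [hcm n]
        have hC20 : 0 < C₂ := lt_of_lt_of_le one_pos (le_max_left _ _)
        calc _ ≤ C₂ * ρ ^ k * (1 / 2) ^ 2 := by
              gcongr
              exact ih _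
          _ ≤ C₂ * ρ ^ k * ρ := by gcongr; linarith
          _ = C₂ * ρ ^ (k + 1) := by ring
  have hC20 : 0 < C₂ := lt_of_lt_of_le one_pos (le_max_left _ _)
  obtain ⟨K, hK⟩ := exists_pow_lt_of_lt_one (show 0 < 1 / (4 * C₂) by positivity) hρ1
  refine ⟨K, fun n => (all K n).trans ?_⟩
  rw [lt_div_iff₀ (by positivity)] at hK
  linarith

theorem le_prod_mul_add_sum {z r g : ℤ → ℝ} {R : ℝ} (hr : ∀ n, 0 ≤ r n) (hR : ∀ n, r n ≤ R)
    (hg : ∀ n, 0 ≤ g n) (hz : ∀ n, z n ≤ r n * z (n + 1) + g n) (k : ℕ) (n : ℤ) :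
    z n ≤ (∏ j ∈ Finset.range k, r (n + j)) * z (n + k) +
      ∑ j ∈ Finset.range k, R ^ j * g (n + j) := by
  induction k with
  | zero => simp
  | succ k ih =>
    have h0 : 0 ≤ ∏ j ∈ Finset.range k, r (n + j) := Finset.prod_nonneg fun j _ => hr _
    have h1 : ∏ j ∈ Finset.range k, r (n + j) ≤ R ^ k := by
      calc _ ≤ ∏ _j ∈ Finset.range k, R := Finset.prod_le_prod (fun j _ => hr _) fun j _ => hR _
        _ = R ^ k := by simp
    have h2 := mul_le_mul_of_nonneg_left (hz (n + k)) h0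
    have h3 := mul_le_mul_of_nonneg_right h1 (hg (n + k))
    rw [Finset.prod_range_succ, Finset.sum_range_succ]
    have e1 : n + ((k + 1 : ℕ) : ℤ) = n + k + 1 := by push_cast; ring
    rw [e1]
    linarith

theorem summable_shift {g : ℤ → ℝ} (hg : Summable g) (k : ℤ) : Summable fun n => g (n + k) :=
  (Equiv.addRight k).summable_iff.mpr hg

theorem tsum_shift (g : ℤ → ℝ) (k : ℤ) : ∑' n, g (n + k) = ∑' n, g n :=
  (Equiv.addRight k).tsum_eq g

/-- After `K` steps the squared homogeneous coefficient is at most `1 / 4`, so squaring leaves half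
of `z (n + K) ^ 2`. The sum over `ℤ` is shift invariant, so this half is absorbed on the left, which
is where a priori summability enters. -/
theorem DominatedData.exists_tsum_sq_le {x m s d : ℤ → ℝ} (h : DominatedData x m s d) :
    ∃ C : ℝ, ∀ z g : ℤ → ℝ, (∀ n, 0 ≤ z n) → (∀ n, 0 ≤ g n) →
      (∀ n, m n * z n ≤ x n * z (n + 1) + g n) →
      Summable (fun n => z n ^ 2) → Summable (fun n => g n ^ 2) →
      ∑' n, z n ^ 2 ≤ C * ∑' n, g n ^ 2 := by
  obtain ⟨K, hK⟩ := h.exists_prod_div_sq_le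
  obtain ⟨A, hA⟩ := h.exists_x_le
  obtain ⟨c, hc, hcm⟩ := h.exists_le_m
  have hm0 : ∀ n, 0 < m n := fun n => hc.trans_le (hcm n)
  have hA0 : 0 ≤ A := (h.x_nonneg 0).trans (hA 0)
  set R := A / c with hR
  set G : ℝ := ∑ j ∈ Finset.range K, (R ^ j / c) ^ 2 with hG
  refine ⟨4 * (K * G), fun z g hz0 hg0 hz hzs hgs => ?_⟩
  have hpt : ∀ n : ℤ, z n ^ 2 ≤ 1 / 2 * z (n + K) ^ 2 +
      2 * (K * ∑ j ∈ Finset.range K, (R ^ j / c) ^ 2 * g (n + j) ^ 2) := by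
    intro n
    have h1 := le_prod_mul_add_sum (z := z) (r := fun n => x n / m n) (g := fun n => g n / c)
      (R := R) (fun n => div_nonneg (h.x_nonneg n) (hm0 n).le)
      (fun n => div_le_div₀ hA0 (hA n) hc (hcm n)) (fun n => div_nonneg (hg0 n) hc.le)
      (fun n => by
        have h1 : z n ≤ (x n * z (n + 1) + g n) / m n := by
          rw [le_div_iff₀ (hm0 n), mul_comm]
          exact hz n
        have h2 : g n / m n ≤ g n / c := div_le_div_of_nonneg_left (hg0 n) hc (hcm n)
        rw [add_div] at h1
        rw [div_mul_eq_mul_div]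
        linarith) K n
    set Q := ∏ j ∈ Finset.range K, x (n + j) / m (n + j)
    have h2 : (∑ j ∈ Finset.range K, R ^ j * (g (n + j) / c)) ^ 2 ≤
        K * ∑ j ∈ Finset.range K, (R ^ j / c) ^ 2 * g (n + j) ^ 2 := by
      have h3 := sq_sum_le_card_mul_sum_sq (s := Finset.range K)
        (f := fun j : ℕ => R ^ j * (g (n + j) / c))
      rw [Finset.card_range] at h3
      refine h3.trans (le_of_eq ?_)
      congr 1
      refine Finset.sum_congr rfl fun j _ => ?_
      ring
    set Y := ∑ j ∈ Finset.range K, R ^ j * (g (n + j) / c)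
    have h4 : z n ^ 2 ≤ (Q * z (n + K) + Y) ^ 2 := pow_le_pow_left₀ (hz0 n) h1 2
    have h5 : Q ^ 2 * z (n + K) ^ 2 ≤ 1 / 4 * z (n + K) ^ 2 := by
      gcongr
      exact hK n
    nlinarith [sq_nonneg (Q * z (n + K) - Y)]
  have hs1 : Summable fun n : ℤ => 1 / 2 * z (n + K) ^ 2 :=
    (summable_shift (g := fun n => z n ^ 2) hzs K).mul_left _
  have hs2 : ∀ j ∈ Finset.range K,
      Summable fun n : ℤ => (R ^ j / c) ^ 2 * g (n + j) ^ 2 := fun j _ =>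
    (summable_shift (g := fun n => g n ^ 2) hgs j).mul_left _
  have hs3 := ((summable_sum hs2).mul_left (K : ℝ)).mul_left 2
  have hle := hzs.tsum_le_tsum hpt (hs1.add hs3)
  rw [hs1.tsum_add hs3, tsum_mul_left, tsum_mul_left, tsum_mul_left, Summable.tsum_finsetSum hs2,
    tsum_shift (fun n => z n ^ 2)] at hle
  simp_rw [tsum_mul_left] at hle
  simp_rw [tsum_shift (fun n => g n ^ 2)] at hle
  rw [← Finset.sum_mul] at hle
  linarith

/-! ### Self-adjointness and the resolvent set -/

theorem hasSum_norm_sq (φ : ℓ²(ℤ, ℂ)) : HasSum (fun n => ‖φ n‖ ^ 2) (‖φ‖ ^ 2) := by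
  have h := lp.hasSum_norm (p := 2) (by norm_num) φ
  simpa using h

/-- The orthogonal complement of the range is the kernel of the adjoint, here `A` itself, and the
bound makes that kernel trivial. -/
theorem isUnit_of_isSelfAdjoint_of_bound {H : Type*} [NormedAddCommGroup H]
    [InnerProductSpace ℂ H] [CompleteSpace H] {A : H →L[ℂ] H} (hA : IsSelfAdjoint A)
    {C : NNReal} (hC : ∀ x, ‖x‖ ≤ C * ‖A x‖) : IsUnit A := by
  have hanti : AntilipschitzWith C A := A.antilipschitz_of_bound hC
  rw [ContinuousLinearMap.isUnit_iff_bijective,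
    ContinuousLinearMap.bijective_iff_dense_range_and_antilipschitz]
  refine ⟨?_, C, hanti⟩
  rw [Submodule.topologicalClosure_eq_top_iff, ContinuousLinearMap.orthogonal_range,
    ← ContinuousLinearMap.star_eq_adjoint, hA.star_eq]
  exact LinearMap.ker_eq_bot.mpr hanti.injective

theorem mem_resolventSet_of_bound {H : Type*} [NormedAddCommGroup H]
    [InnerProductSpace ℂ H] [CompleteSpace H] {A : H →L[ℂ] H} (hA : IsSelfAdjoint A) (E : ℂ)
    {C : NNReal} (hC : ∀ x, ‖x‖ ≤ C * ‖(algebraMap ℂ (H →L[ℂ] H) E - A) x‖) :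
    E ∈ resolventSet ℂ A := by
  by_cases hE : E ∈ spectrum ℂ A
  · have hre : E = E.re := hA.mem_spectrum_eq_re hE
    refine isUnit_of_isSelfAdjoint_of_bound (.sub ?_ hA) hC
    rw [hre]
    exact .algebraMap _ (Complex.conj_ofReal _)
  · exact spectrum.notMem_iff.mp hE

theorem jacobiOperator_isSelfAdjoint {Ω : Type*} [MetricSpace Ω] [CompactSpace Ω] (T : Ω ≃ₜ Ω)
    (a : C(Ω, ℂ)) (b : C(Ω, ℝ)) (ω : Ω) : IsSelfAdjoint (jacobiOperator T a b ω) := by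
  rw [ContinuousLinearMap.isSelfAdjoint_iff_isSymmetric]
  intro φ ψ
  simp only [ContinuousLinearMap.coe_coe]
  set W₁ := weightedShift (fun n => conj (a ((T ^ (n - 1)) ω))) ‖a‖
      (fun n => by simpa using a.norm_coe_le_norm ((T ^ (n - 1)) ω)) (-1) with hW₁
  set W₂ := weightedShift (fun n => a ((T ^ n) ω)) ‖a‖
    (fun n => a.norm_coe_le_norm ((T ^ n) ω)) 1 with hW₂
  set W₃ := weightedShift (fun n => (b ((T ^ n) ω) : ℂ)) ‖b‖
      (fun n => by simpa using b.norm_coe_le_norm ((T ^ n) ω)) 0 with hW₃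
  have hJ : jacobiOperator T a b ω = W₁ + W₂ + W₃ := rfl
  have h12 : ∀ φ ψ : ℓ²(ℤ, ℂ), inner ℂ (W₁ φ) ψ = inner ℂ φ (W₂ ψ) := by
    intro φ ψ
    rw [lp.inner_eq_tsum, lp.inner_eq_tsum, ← (Equiv.addRight (1 : ℤ)).tsum_eq]
    refine tsum_congr fun n => ?_
    simp [hW₁, hW₂, weightedShift_apply]
    ring
  have h21 : inner ℂ (W₂ φ) ψ = inner ℂ φ (W₁ ψ) := by
    rw [← inner_conj_symm, ← h12, inner_conj_symm]
  have h33 : inner ℂ (W₃ φ) ψ = inner ℂ φ (W₃ ψ) := by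
    rw [lp.inner_eq_tsum, lp.inner_eq_tsum]
    refine tsum_congr fun n => ?_
    simp [hW₃, weightedShift_apply]
    ring
  rw [hJ]
  simp only [add_apply, inner_add_left, inner_add_right, h12, h21, h33]
  ring

/-! ### Lines in `ℂ²` -/

theorem mem_line_coe {z : ℂ} {v : EuclideanSpace ℂ (Fin 2)} :
    v ∈ line (z : OnePoint ℂ) ↔ v 1 = z * v 0 := by
  change v ∈ Submodule.span ℂ {!₂[1, z]} ↔ _
  rw [Submodule.mem_span_singleton]
  constructor
  · rintro ⟨c, rfl⟩
    simp [mul_comm]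
  · intro h
    refine ⟨v 0, ?_⟩
    ext i
    fin_cases i <;> simp [h, mul_comm]

theorem mem_line_infty {v : EuclideanSpace ℂ (Fin 2)} :
    v ∈ line OnePoint.infty ↔ v 0 = 0 := by
  change v ∈ Submodule.span ℂ {!₂[0, 1]} ↔ _
  rw [Submodule.mem_span_singleton]
  constructor
  · rintro ⟨c, rfl⟩
    simp
  · intro h
    refine ⟨v 1, ?_⟩
    ext i
    fin_cases i <;> simp [h]

theorem det_eq_zero_of_mem_line {z : OnePoint ℂ} {v w : EuclideanSpace ℂ (Fin 2)}
    (hv : v ∈ line z) (hw : w ∈ line z) : v 0 * w 1 - v 1 * w 0 = 0 := by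
  induction z using OnePoint.rec with
  | infty =>
    rw [mem_line_infty] at hv hw
    simp [hv, hw]
  | coe z =>
    rw [mem_line_coe] at hv hw
    rw [hv, hw]
    ring

theorem exists_mem_line_norm_eq_one (z : OnePoint ℂ) : ∃ v ∈ line z, ‖v‖ = 1 := by
  obtain ⟨w, hw, hw0⟩ : ∃ w ∈ line z, w ≠ 0 := by
    induction z using OnePoint.rec with
    | infty =>
      refine ⟨!₂[0, 1], mem_line_infty.mpr (by simp), fun h => ?_⟩
      simpa using congr_arg (fun v : EuclideanSpace ℂ (Fin 2) => v 1) h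
    | coe z =>
      refine ⟨!₂[1, z], mem_line_coe.mpr (by simp), fun h => ?_⟩
      simpa using congr_arg (fun v : EuclideanSpace ℂ (Fin 2) => v 0) h
  refine ⟨((‖w‖⁻¹ : ℝ) : ℂ) • w, Submodule.smul_mem _ _ hw, ?_⟩
  have : ‖w‖ ≠ 0 := norm_ne_zero_iff.mpr hw0
  simp [norm_smul, this]

theorem exists_smul_eq_of_det_eq_zero {v w : EuclideanSpace ℂ (Fin 2)} (hw : w ≠ 0)
    (h : v 0 * w 1 - v 1 * w 0 = 0) : ∃ c : ℂ, v = c • w := by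
  by_cases h0 : w 0 = 0
  · have h1 : w 1 ≠ 0 := fun h1 => hw (by ext i; fin_cases i <;> simp [h0, h1])
    refine ⟨v 1 / w 1, ?_⟩
    ext i
    fin_cases i
    · simp [h0] at h ⊢
      tauto
    · simp [h1]
  · refine ⟨v 0 / w 0, ?_⟩
    ext i
    fin_cases i
    · simp [h0]
    · simp
      field_simp
      linear_combination -h

/-- The continuous function `z ↦ (1 + ‖z‖²)⁻¹` on the Riemann sphere. -/
noncomputable def sphereHeight : OnePoint ℂ → ℝ
  | some z => (1 + ‖z‖ ^ 2)⁻¹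
  | none => 0

/-- The continuous function `z ↦ z (1 + ‖z‖²)⁻¹` on the Riemann sphere. -/
noncomputable def spherePlane : OnePoint ℂ → ℂ
  | some z => z * ((1 + ‖z‖ ^ 2)⁻¹ : ℝ)
  | none => 0

theorem tendsto_norm_coclosedCompact :
    Filter.Tendsto (fun z : ℂ => ‖z‖) (Filter.coclosedCompact ℂ) Filter.atTop := by
  rw [Filter.coclosedCompact_eq_cocompact]
  exact tendsto_norm_cocompact_atTop

theorem continuous_sphereHeight : Continuous sphereHeight := by
  rw [OnePoint.continuous_iff]
  constructor
  · change Filter.Tendsto (fun z : ℂ => (1 + ‖z‖ ^ 2)⁻¹) _ (nhds 0)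
    refine Filter.Tendsto.inv_tendsto_atTop (Filter.tendsto_atTop_add_const_left _ _ ?_)
    exact (Filter.tendsto_pow_atTop (by norm_num)).comp tendsto_norm_coclosedCompact
  · change Continuous (fun z : ℂ => (1 + ‖z‖ ^ 2)⁻¹)
    exact Continuous.inv₀ (by fun_prop) (fun z => by positivity)

theorem continuous_spherePlane : Continuous spherePlane := by
  rw [OnePoint.continuous_iff]
  constructor
  · change Filter.Tendsto (fun z : ℂ => z * ((1 + ‖z‖ ^ 2)⁻¹ : ℝ)) _ (nhds 0)
    refine squeeze_zero_norm' (a := fun z : ℂ => ‖z‖⁻¹) ?_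
      tendsto_norm_coclosedCompact.inv_tendsto_atTop
    filter_upwards [tendsto_norm_coclosedCompact.eventually_gt_atTop 0] with z hz
    have h1 : (0 : ℝ) < 1 + ‖z‖ ^ 2 := by positivity
    rw [norm_mul, Complex.norm_real, Real.norm_of_nonneg (by positivity), ← div_eq_mul_inv,
      div_le_iff₀ h1, inv_mul_eq_div, le_div_iff₀ hz]
    nlinarith
  · change Continuous (fun z : ℂ => z * ((1 + ‖z‖ ^ 2)⁻¹ : ℝ))
    have : Continuous (fun z : ℂ => (1 + ‖z‖ ^ 2)⁻¹) :=
      Continuous.inv₀ (by fun_prop) (fun z => by positivity)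
    fun_prop

/-- `sphereHeight` and `spherePlane` give the entries of the orthogonal projection onto the line;
the two equations say that `v` is parallel to both of its columns. At `∞` the first column vanishes,
so the second is needed. -/
theorem mem_line_iff {z : OnePoint ℂ} {v : EuclideanSpace ℂ (Fin 2)} :
    v ∈ line z ↔ v 1 * sphereHeight z = v 0 * spherePlane z ∧
      v 1 * conj (spherePlane z) = v 0 * (1 - sphereHeight z) := by
  induction z using OnePoint.rec with
  | infty =>
    have h1 : sphereHeight OnePoint.infty = 0 := rfl
    have h2 : spherePlane OnePoint.infty = 0 := rfl
    simp [mem_line_infty, h1, h2, eq_comm]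
  | coe z =>
    have h1 : sphereHeight (z : OnePoint ℂ) = (1 + ‖z‖ ^ 2)⁻¹ := rfl
    have h2 : spherePlane (z : OnePoint ℂ) = z * ((1 + ‖z‖ ^ 2)⁻¹ : ℝ) := rfl
    have h3 : (1 + (‖z‖ : ℂ) ^ 2) ≠ 0 := by
      have : (0 : ℝ) < 1 + ‖z‖ ^ 2 := by positivity
      exact_mod_cast this.ne'
    have h4 : conj z * z = (‖z‖ : ℂ) ^ 2 := Complex.conj_mul' z
    rw [mem_line_coe, h1, h2]
    simp only [map_mul, Complex.conj_ofReal]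
    push_cast
    constructor
    · intro h
      rw [h]
      constructor
      · ring
      · field_simp
        linear_combination v 0 * h4
    · rintro ⟨h, -⟩
      field_simp at h
      linear_combination h

theorem isClosed_setOf_mem_line {X : Type*} [TopologicalSpace X] {f : X → OnePoint ℂ}
    {g : X → EuclideanSpace ℂ (Fin 2)} (hf : Continuous f) (hg : Continuous g) :
    IsClosed {x | g x ∈ line (f x)} := by
  simp only [mem_line_iff]
  have h1 := continuous_sphereHeight.comp hf
  have h2 := continuous_spherePlane.comp hf
  simp only [Function.comp_def] at h1 h2
  have h3 := Complex.continuous_conj.comp h2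
  simp only [Function.comp_def] at h3
  have h4 := Complex.continuous_ofReal.comp h1
  simp only [Function.comp_def] at h4
  have hg0 : Continuous fun x => g x 0 := by fun_prop
  have hg1 : Continuous fun x => g x 1 := by fun_prop
  exact (isClosed_eq (hg1.mul h4) (hg0.mul h2)).inter
    (isClosed_eq (hg1.mul h3) (hg0.mul (continuous_const.sub h4)))

/-! ### Invariant frames and the difference equation along an orbit -/

/-- A frame `(u, v)`, `(s, t)` of `ℂ²` along `ℤ` in which the Jacobi cocycle with coefficients
`a`, `e` is diagonal with multipliers `μ`, `σ`, the first direction dominating the second. -/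
structure DominatedFrame (a e u v s t μ σ : ℤ → ℂ) : Prop where
  map_u : ∀ n, e n * u n - conj (a (n - 1)) * v n = μ n * u (n + 1)
  map_v : ∀ n, a n * u n = μ n * v (n + 1)
  map_s : ∀ n, e n * s n - conj (a (n - 1)) * t n = σ n * s (n + 1)
  map_t : ∀ n, a n * s n = σ n * t (n + 1)
  norm_le : ∀ n, ‖u n‖ ≤ 1 ∧ ‖v n‖ ≤ 1 ∧ ‖s n‖ ≤ 1 ∧ ‖t n‖ ≤ 1
  exists_norm_le : ∃ A, ∀ n, ‖a n‖ ≤ A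
  exists_le_norm : ∃ c > 0, ∀ n, c ≤ ‖μ n‖ ∧ c ≤ ‖u n * t n - v n * s n‖
  dominated : ∃ N : ℕ, 0 < N ∧ ∃ lam : ℝ, 1 < lam ∧ ∀ n : ℤ,
    lam * ∏ j ∈ Finset.range N, ‖σ (n + j)‖ ≤ ∏ j ∈ Finset.range N, ‖μ (n + j)‖

variable {a e u v s t μ σ : ℤ → ℂ}

theorem DominatedFrame.norm_det_le (h : DominatedFrame a e u v s t μ σ) (n : ℤ) :
    ‖u n * t n - v n * s n‖ ≤ 2 := by
  obtain ⟨h1, h2, h3, h4⟩ := h.norm_le n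
  calc _ ≤ ‖u n * t n‖ + ‖v n * s n‖ := norm_sub_le _ _
    _ ≤ 1 * 1 + 1 * 1 := by
      rw [norm_mul, norm_mul]
      gcongr
    _ = 2 := by norm_num

theorem DominatedFrame.norm_det_eq (h : DominatedFrame a e u v s t μ σ) (n : ℤ) :
    ‖μ n‖ * ‖σ n‖ * ‖u (n + 1) * t (n + 1) - v (n + 1) * s (n + 1)‖ =
      ‖a n‖ * ‖a (n - 1)‖ * ‖u n * t n - v n * s n‖ := by
  rw [← Complex.norm_conj (a (n - 1))]
  simp only [← norm_mul]
  congr 1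
  linear_combination (-σ n * t (n + 1)) * h.map_u n + (σ n * s (n + 1)) * h.map_v n
    - (e n * u n - conj (a (n - 1)) * v n) * h.map_t n + a n * u n * h.map_s n

/-- Data for the coordinate controlled by its successor. The determinant ratios in its recursion
multiply both directions alike, so domination is unaffected. -/
theorem DominatedFrame.dominatedData (h : DominatedFrame a e u v s t μ σ) :
    DominatedData (fun n => ‖a n‖)
      (fun n => ‖μ n‖ * (‖u (n + 1) * t (n + 1) - v (n + 1) * s (n + 1)‖ /
        ‖u n * t n - v n * s n‖))
      (fun n => ‖σ n‖ * (‖u (n + 1) * t (n + 1) - v (n + 1) * s (n + 1)‖ /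
        ‖u n * t n - v n * s n‖))
      (fun n => ‖u n * t n - v n * s n‖⁻¹) := by
  have hdet := h.norm_det_eq
  have hd2 := h.norm_det_le
  obtain ⟨c, hc, hcle⟩ := h.exists_le_norm
  obtain ⟨N, hN, lam, hlam, hdom⟩ := h.dominated
  generalize hd : (fun n => ‖u n * t n - v n * s n‖) = d at *
  replace hd : ∀ n, ‖u n * t n - v n * s n‖ = d n := fun n => congr_fun hd n
  simp only [hd] at *
  have hd0 : ∀ n, 0 < d n := fun n => hc.trans_le (hcle n).2
  refine ⟨fun n => norm_nonneg _, fun n => ?_, h.exists_norm_le, ⟨c * (c / 2), by positivity,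
    fun n => ?_⟩, ⟨2⁻¹, by norm_num, fun n => ?_⟩, ⟨c⁻¹, fun n => ?_⟩, fun n => ?_,
    N, hN, lam, hlam, fun n => ?_⟩
  · have := hd0 n
    have := hd0 (n + 1)
    positivity
  · have := hd0 n
    exact mul_le_mul (hcle n).1 (div_le_div₀ (hd0 _).le (hcle _).2 this (hd2 n)) (by positivity)
      (norm_nonneg _)
  · exact inv_anti₀ (hd0 n) (hd2 n)
  · exact inv_anti₀ hc (hcle n).2
  · have h1 := (hd0 n).ne'
    have h2 := (hd0 (n + 1)).ne'
    have h3 := hdet n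
    field_simp
    linear_combination h3
  · simp only [Finset.prod_mul_distrib]
    rw [← mul_assoc]
    refine mul_le_mul_of_nonneg_right (hdom n) (Finset.prod_nonneg fun j _ => ?_)
    exact div_nonneg (hd0 _).le (hd0 _).le

/-- Data for the other coordinate, controlled by its predecessor: reversing the orbit gives both
recursions the same form. -/
theorem DominatedFrame.dominatedData_reflect (h : DominatedFrame a e u v s t μ σ) :
    DominatedData (fun n => ‖a (-n - 1)‖) (fun n => ‖μ (-n)‖) (fun n => ‖σ (-n)‖)
      (fun n => ‖u (1 - n) * t (1 - n) - v (1 - n) * s (1 - n)‖⁻¹) := by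
  have hdet := h.norm_det_eq
  obtain ⟨c, hc, hcle⟩ := h.exists_le_norm
  obtain ⟨N, hN, lam, hlam, hdom⟩ := h.dominated
  obtain ⟨A, hA⟩ := h.exists_norm_le
  refine ⟨fun n => norm_nonneg _, fun n => norm_nonneg _, ⟨A, fun n => hA _⟩,
    ⟨c, hc, fun n => (hcle _).1⟩, ⟨2⁻¹, by norm_num, fun n => ?_⟩, ⟨c⁻¹, fun n => ?_⟩,
    fun n => ?_, N, hN, lam, hlam, fun n => ?_⟩
  · exact inv_anti₀ (hc.trans_le (hcle _).2) (h.norm_det_le _)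
  · exact inv_anti₀ hc (hcle _).2
  · have h1 := hdet (-n)
    have h2 := (hc.trans_le (hcle (-n)).2).ne'
    have h3 := (hc.trans_le (hcle (-n + 1)).2).ne'
    have e1 : 1 - (n + 1) = -n := by ring
    have e2 : 1 - n = -n + 1 := by ring
    have e3 : -(n - 1) - 1 = -n := by ring
    rw [e1, e2, e3]
    field_simp
    linear_combination h1
  · have key : ∀ g : ℤ → ℂ, ∏ j ∈ Finset.range N, ‖g (-(n + j))‖ =
        ∏ j ∈ Finset.range N, ‖g (-n - N + 1 + j)‖ := by
      intro g
      rw [← Finset.prod_range_reflect]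
      refine Finset.prod_congr rfl fun j hj => ?_
      have hj' := Finset.mem_range.mp hj
      congr 2
      omega
    simp only [key]
    exact hdom _

set_option maxHeartbeats 1000000 in
theorem DominatedFrame.exists_tsum_sq_le (h : DominatedFrame a e u v s t μ σ) :
    ∃ C : ℝ, ∀ φ f : ℤ → ℂ, Summable (fun n => ‖φ n‖ ^ 2) → Summable (fun n => ‖f n‖ ^ 2) →
      (∀ n, e n * φ n - conj (a (n - 1)) * φ (n - 1) = a n * φ (n + 1) + f n) →
      ∑' n, ‖φ n‖ ^ 2 ≤ C * ∑' n, ‖f n‖ ^ 2 := by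
  obtain ⟨C₁, hC₁⟩ := h.dominatedData.exists_tsum_sq_le
  obtain ⟨C₂, hC₂⟩ := h.dominatedData_reflect.exists_tsum_sq_le
  obtain ⟨c, hc, hcle⟩ := h.exists_le_norm
  refine ⟨2 / c ^ 2 * (C₁ + C₂), fun φ f hφ hf hφf => ?_⟩
  -- Cramer's rule: up to the frame determinant, `X` and `Y` are the coordinates of `(φ n, φ (n-1))`
  -- along `(u, v)` and `(s, t)`.
  set X : ℤ → ℂ := fun n => φ n * t n - φ (n - 1) * s n with hX
  set Y : ℤ → ℂ := fun n => u n * φ (n - 1) - v n * φ n with hY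
  have hφ' : Summable (fun n => ‖φ (n - 1)‖ ^ 2) := by
    simpa [sub_eq_add_neg] using summable_shift hφ (-1)
  have hsum : Summable fun n => 2 * (‖φ n‖ ^ 2 + ‖φ (n - 1)‖ ^ 2) := (hφ.add hφ').mul_left 2
  have hXs : Summable (fun n => ‖X n‖ ^ 2) := by
    refine Summable.of_nonneg_of_le (fun n => by positivity) (fun n => ?_) hsum
    obtain ⟨-, -, h3, h4⟩ := h.norm_le n
    have h5 : ‖X n‖ ≤ ‖φ n‖ + ‖φ (n - 1)‖ := by
      calc ‖X n‖ ≤ ‖φ n * t n‖ + ‖φ (n - 1) * s n‖ := norm_sub_le _ _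
        _ ≤ ‖φ n‖ * 1 + ‖φ (n - 1)‖ * 1 := by rw [norm_mul, norm_mul]; gcongr
        _ = _ := by ring
    have := pow_le_pow_left₀ (norm_nonneg _) h5 2
    linarith [add_sq_le (a := ‖φ n‖) (b := ‖φ (n - 1)‖)]
  have hYs : Summable (fun n => ‖Y n‖ ^ 2) := by
    refine Summable.of_nonneg_of_le (fun n => by positivity) (fun n => ?_) hsum
    obtain ⟨h1, h2, -, -⟩ := h.norm_le n
    have h5 : ‖Y n‖ ≤ ‖φ n‖ + ‖φ (n - 1)‖ := by
      calc ‖Y n‖ ≤ ‖u n * φ (n - 1)‖ + ‖v n * φ n‖ := norm_sub_le _ _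
        _ ≤ 1 * ‖φ (n - 1)‖ + 1 * ‖φ n‖ := by rw [norm_mul, norm_mul]; gcongr
        _ = _ := by ring
    have := pow_le_pow_left₀ (norm_nonneg _) h5 2
    linarith [add_sq_le (a := ‖φ n‖) (b := ‖φ (n - 1)‖)]
  have hXrec : ∀ n, ‖μ n‖ * (‖u (n + 1) * t (n + 1) - v (n + 1) * s (n + 1)‖ /
      ‖u n * t n - v n * s n‖) * ‖X n‖ ≤ ‖a n‖ * ‖X (n + 1)‖ + ‖f n‖ := by
    intro n
    have hd : 0 < ‖u n * t n - v n * s n‖ := hc.trans_le (hcle n).2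
    have hrec : μ n * (u (n + 1) * t (n + 1) - v (n + 1) * s (n + 1)) * X n =
        (u n * t n - v n * s n) * (a n * X (n + 1) + f n * t (n + 1)) := by
      have h1 : (u n * t n - v n * s n) * (a n * φ (n + 1) + f n) =
          X n * (μ n * u (n + 1)) + Y n * (σ n * s (n + 1)) := by
        simp only [hX, hY]
        rw [← h.map_u n, ← h.map_s n, ← hφf n]
        ring
      have h2 : (u n * t n - v n * s n) * (a n * φ n) =
          X n * (μ n * v (n + 1)) + Y n * (σ n * t (n + 1)) := by
        simp only [hX, hY]
        rw [← h.map_v n, ← h.map_t n]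
        ring
      have h3 : X (n + 1) = φ (n + 1) * t (n + 1) - φ n * s (n + 1) := by simp [hX]
      rw [h3]
      linear_combination -t (n + 1) * h1 + s (n + 1) * h2
    have hle : ‖a n * X (n + 1) + f n * t (n + 1)‖ ≤ ‖a n‖ * ‖X (n + 1)‖ + ‖f n‖ := by
      calc _ ≤ ‖a n * X (n + 1)‖ + ‖f n * t (n + 1)‖ := norm_add_le _ _
        _ ≤ ‖a n‖ * ‖X (n + 1)‖ + ‖f n‖ * 1 := by
          rw [norm_mul, norm_mul]
          gcongr
          exact (h.norm_le _).2.2.2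
        _ = _ := by ring
    have hn := congr_arg norm hrec
    rw [norm_mul, norm_mul, norm_mul] at hn
    rw [← mul_div_assoc, div_mul_eq_mul_div, hn, mul_div_cancel_left₀ _ hd.ne']
    exact hle
  have hYrec : ∀ n, ‖μ (-n)‖ * ‖Y (1 - n)‖ ≤ ‖a (-n - 1)‖ * ‖Y (1 - (n + 1))‖ + ‖f (-n)‖ := by
    intro n
    -- This uses the `u`, `v` equations only, a Wronskian computation. Solving the `σ` recursion
    -- forward would require dividing by `a`, which may vanish.
    have hrec : μ (-n) * Y (-n + 1) = conj (a (-n - 1)) * Y (-n) + f (-n) * u (-n) := by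
      simp only [hY, add_sub_cancel_right]
      linear_combination (-φ (-n)) * h.map_u (-n) + φ (-n + 1) * h.map_v (-n) +
        u (-n) * hφf (-n)
    have e1 : 1 - n = -n + 1 := by ring
    have e2 : 1 - (n + 1) = -n := by ring
    rw [e1, e2, ← norm_mul, hrec]
    calc _ ≤ ‖conj (a (-n - 1)) * Y (-n)‖ + ‖f (-n) * u (-n)‖ := norm_add_le _ _
      _ ≤ ‖a (-n - 1)‖ * ‖Y (-n)‖ + ‖f (-n)‖ * 1 := by
        rw [norm_mul, norm_mul, Complex.norm_conj]
        gcongr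
        exact (h.norm_le _).1
      _ = _ := by ring
  have hXb := hC₁ (fun n => ‖X n‖) (fun n => ‖f n‖) (fun n => norm_nonneg _)
    (fun n => norm_nonneg _) hXrec hXs hf
  have hYb := hC₂ (fun n => ‖Y (1 - n)‖) (fun n => ‖f (-n)‖) (fun n => norm_nonneg _)
    (fun n => norm_nonneg _) hYrec ((Equiv.subLeft (1 : ℤ)).summable_iff.mpr hYs)
    ((Equiv.neg ℤ).summable_iff.mpr hf)
  have hYr : ∑' n, ‖Y (1 - n)‖ ^ 2 = ∑' n, ‖Y n‖ ^ 2 :=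
    (Equiv.subLeft (1 : ℤ)).tsum_eq (fun n => ‖Y n‖ ^ 2)
  have hfr : ∑' n, ‖f (-n)‖ ^ 2 = ∑' n, ‖f n‖ ^ 2 :=
    (Equiv.neg ℤ).tsum_eq (fun n => ‖f n‖ ^ 2)
  rw [hYr, hfr] at hYb
  have hpt : ∀ n, ‖φ n‖ ^ 2 ≤ 2 / c ^ 2 * (‖X n‖ ^ 2 + ‖Y n‖ ^ 2) := by
    intro n
    obtain ⟨h1, -, h3, -⟩ := h.norm_le n
    have h5 : (u n * t n - v n * s n) * φ n = X n * u n + Y n * s n := by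
      simp only [hX, hY]
      ring
    have h6 : c * ‖φ n‖ ≤ ‖X n‖ + ‖Y n‖ := by
      calc c * ‖φ n‖ ≤ ‖u n * t n - v n * s n‖ * ‖φ n‖ := by gcongr; exact (hcle n).2
        _ = ‖X n * u n + Y n * s n‖ := by rw [← norm_mul, h5]
        _ ≤ ‖X n * u n‖ + ‖Y n * s n‖ := norm_add_le _ _
        _ ≤ ‖X n‖ * 1 + ‖Y n‖ * 1 := by rw [norm_mul, norm_mul]; gcongr
        _ = _ := by ring
    have h7 := pow_le_pow_left₀ (by positivity) h6 2
    rw [div_mul_eq_mul_div, le_div_iff₀ (by positivity)]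
    linarith [add_sq_le (a := ‖X n‖) (b := ‖Y n‖), mul_pow c ‖φ n‖ 2]
  have hle := hφ.tsum_le_tsum hpt ((hXs.add hYs).mul_left _)
  rw [tsum_mul_left, hXs.tsum_add hYs] at hle
  calc _ ≤ _ := hle
    _ ≤ 2 / c ^ 2 * (C₁ * ∑' n, ‖f n‖ ^ 2 + C₂ * ∑' n, ‖f n‖ ^ 2) := by gcongr
    _ = _ := by ring

/-! ### Frames from a dominated splitting -/

section Splitting

variable {Ω : Type*} [MetricSpace Ω] {T : Ω ≃ₜ Ω} {B : C(Ω, Matrix (Fin 2) (Fin 2) ℂ)}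

theorem toEuclideanLin_cocycleIter {w : Ω → EuclideanSpace ℂ (Fin 2)} {ν : Ω → ℂ}
    (hw : ∀ ω, Matrix.toEuclideanLin (B ω) (w ω) = ν ω • w (T ω)) (k : ℕ) (ω : Ω) :
    Matrix.toEuclideanLin (cocycleIter T B k ω) (w ω) =
      (∏ j ∈ Finset.range k, ν ((T ^ j) ω)) • w ((T ^ k) ω) := by
  induction k with
  | zero =>
    ext i
    simp [cocycleIter]
  | succ k ih =>
    have h1 : Matrix.toEuclideanLin (cocycleIter T B (k + 1) ω) (w ω) =
        Matrix.toEuclideanLin (B ((T ^ k) ω))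
          (Matrix.toEuclideanLin (cocycleIter T B k ω) (w ω)) := by
      simp [cocycleIter, Matrix.toLpLin_apply]
    have h2 : (T ^ (k + 1)) ω = T ((T ^ k) ω) := by rw [pow_succ']; rfl
    rw [h1, ih, map_smul, hw, smul_smul, Finset.prod_range_succ, h2]

theorem exists_multiplier {F : Ω → OnePoint ℂ} {w : Ω → EuclideanSpace ℂ (Fin 2)}
    (hF : ∀ ω, (line (F ω)).map (Matrix.toEuclideanLin (B ω)) ≤ line (F (T ω)))
    (hw : ∀ ω, w ω ∈ line (F ω)) (hw1 : ∀ ω, ‖w ω‖ = 1) (ω : Ω) :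
    ∃ ν : ℂ, Matrix.toEuclideanLin (B ω) (w ω) = ν • w (T ω) := by
  refine exists_smul_eq_of_det_eq_zero (fun h => by simpa [h] using hw1 (T ω)) ?_
  exact det_eq_zero_of_mem_line (hF ω (Submodule.mem_map_of_mem (hw ω))) (hw _)

variable [CompactSpace Ω]

/-- Unit vectors in the lines are later chosen without continuity, so the bound is taken over the
compact set of all such pairs, closed by `isClosed_setOf_mem_line`. -/
theorem exists_pos_le_on_lines {Es Eu : C(Ω, OnePoint ℂ)}
    {f : Ω → EuclideanSpace ℂ (Fin 2) → EuclideanSpace ℂ (Fin 2) → ℝ}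
    (hf : Continuous fun p : Ω × EuclideanSpace ℂ (Fin 2) × EuclideanSpace ℂ (Fin 2) =>
      f p.1 p.2.1 p.2.2)
    (hpos : ∀ ω, ∀ u ∈ line (Eu ω), ∀ s ∈ line (Es ω), ‖u‖ = 1 → ‖s‖ = 1 → 0 < f ω u s) :
    ∃ c > 0, ∀ ω, ∀ u ∈ line (Eu ω), ∀ s ∈ line (Es ω), ‖u‖ = 1 → ‖s‖ = 1 → c ≤ f ω u s := by
  have hK : IsCompact {p : Ω × EuclideanSpace ℂ (Fin 2) × EuclideanSpace ℂ (Fin 2) |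
      p ∈ Set.univ ×ˢ (Metric.sphere 0 1 ×ˢ Metric.sphere 0 1) ∧
        p.2.1 ∈ line (Eu p.1) ∧ p.2.2 ∈ line (Es p.1)} := by
    refine (isCompact_univ.prod ((isCompact_sphere _ _).prod (isCompact_sphere _ _))).inter_right
      (IsClosed.inter ?_ ?_)
    · exact isClosed_setOf_mem_line (Eu.continuous.comp continuous_fst)
        (continuous_fst.comp continuous_snd)
    · exact isClosed_setOf_mem_line (Es.continuous.comp continuous_fst)
        (continuous_snd.comp continuous_snd)
  obtain ⟨c, hc, h⟩ := hK.exists_forall_le' (a := 0) hf.continuousOn (by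
    rintro ⟨ω, u, s⟩ ⟨⟨-, hu1, hs1⟩, hu, hs⟩
    exact hpos ω u hu s hs (by simpa using hu1) (by simpa using hs1))
  exact ⟨c, hc, fun ω u hu s hs hu1 hs1 =>
    h (ω, u, s) ⟨⟨trivial, by simpa using hu1, by simpa using hs1⟩, hu, hs⟩⟩

theorem DominatedSplitting.exists_frame (hDS : DominatedSplitting T B) :
    ∃ (u s : Ω → EuclideanSpace ℂ (Fin 2)) (μ σ : Ω → ℂ) (c : ℝ), 0 < c ∧
      (∀ ω, ‖u ω‖ = 1) ∧ (∀ ω, ‖s ω‖ = 1) ∧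
      (∀ ω, Matrix.toEuclideanLin (B ω) (u ω) = μ ω • u (T ω)) ∧
      (∀ ω, Matrix.toEuclideanLin (B ω) (s ω) = σ ω • s (T ω)) ∧
      (∀ ω, c ≤ ‖μ ω‖) ∧ (∀ ω, c ≤ ‖u ω 0 * s ω 1 - u ω 1 * s ω 0‖) ∧
      ∃ N : ℕ, 0 < N ∧ ∃ lam : ℝ, 1 < lam ∧ ∀ ω,
        lam * ∏ j ∈ Finset.range N, ‖σ ((T ^ j) ω)‖ ≤ ∏ j ∈ Finset.range N, ‖μ ((T ^ j) ω)‖ := by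
  obtain ⟨Es, Eu, hinv, N, hN, lam, hlam, hdom⟩ := hDS
  choose u hu hu1 using fun ω => exists_mem_line_norm_eq_one (Eu ω)
  choose s hs hs1 using fun ω => exists_mem_line_norm_eq_one (Es ω)
  choose μ hμ using exists_multiplier (fun ω => (hinv ω).2) hu hu1
  choose σ hσ using exists_multiplier (fun ω => (hinv ω).1) hs hs1
  have hdomlt : ∀ ω, lam * ∏ j ∈ Finset.range N, ‖σ ((T ^ j) ω)‖ <
      ∏ j ∈ Finset.range N, ‖μ ((T ^ j) ω)‖ := by
    intro ω
    have h1 := hdom ω _ (hu ω) _ (hs ω) (hu1 ω) (hs1 ω)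
    rwa [toEuclideanLin_cocycleIter hμ, toEuclideanLin_cocycleIter hσ, norm_smul, norm_smul,
      hu1, hs1, mul_one, mul_one, norm_prod, norm_prod] at h1
  have hμ0 : ∀ ω, μ ω ≠ 0 := by
    intro ω h0
    have h1 : ∏ j ∈ Finset.range N, ‖μ ((T ^ j) ω)‖ = 0 :=
      Finset.prod_eq_zero (Finset.mem_range.mpr hN) (by simp [h0])
    have h2 := hdomlt ω
    rw [h1] at h2
    have h3 : 0 ≤ ∏ j ∈ Finset.range N, ‖σ ((T ^ j) ω)‖ :=
      Finset.prod_nonneg fun j _ => norm_nonneg _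
    have : 0 ≤ lam * ∏ j ∈ Finset.range N, ‖σ ((T ^ j) ω)‖ := by positivity
    linarith
  have hBcont : Continuous fun p : Ω × EuclideanSpace ℂ (Fin 2) × EuclideanSpace ℂ (Fin 2) =>
      ‖Matrix.toEuclideanLin (B p.1) p.2.1‖ :=
    ((PiLp.continuous_toLp 2 _).comp ((B.continuous.comp continuous_fst).matrix_mulVec
      ((PiLp.continuous_ofLp 2 _).comp (continuous_fst.comp continuous_snd)))).norm
  have hDcont : Continuous fun p : Ω × EuclideanSpace ℂ (Fin 2) × EuclideanSpace ℂ (Fin 2) =>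
      ‖p.2.1 0 * p.2.2 1 - p.2.1 1 * p.2.2 0‖ := by fun_prop
  obtain ⟨c₁, hc₁, h₁⟩ := exists_pos_le_on_lines (Es := Es) (Eu := Eu)
    (f := fun ω x _ => ‖Matrix.toEuclideanLin (B ω) x‖) hBcont (by
      intro ω x hxl y hyl hx hy
      have hu0 : u ω ≠ 0 := fun h => by simpa [h] using hu1 ω
      obtain ⟨κ, rfl⟩ := exists_smul_eq_of_det_eq_zero hu0 (det_eq_zero_of_mem_line hxl (hu ω))
      rw [norm_smul, hu1, mul_one] at hx
      simp only [map_smul, hμ, norm_smul, hx, hu1, one_mul, mul_one]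
      exact norm_pos_iff.mpr (hμ0 ω))
  obtain ⟨c₂, hc₂, h₂⟩ := exists_pos_le_on_lines (Es := Es) (Eu := Eu)
    (f := fun _ x y => ‖x 0 * y 1 - x 1 * y 0‖) hDcont (by
      intro ω x hxl y hyl hx hy
      refine norm_pos_iff.mpr fun h0 => ?_
      have hy0 : y ≠ 0 := fun h => by simp [h] at hy
      -- Proportional unit vectors have images of equal norm, contradicting domination.
      obtain ⟨κ, rfl⟩ := exists_smul_eq_of_det_eq_zero hy0 h0
      have h1 := hdom ω _ hxl _ hyl hx hy
      rw [norm_smul, hy, mul_one] at hx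
      rw [map_smul, norm_smul, hx, one_mul] at h1
      exact h1.not_ge (le_mul_of_one_le_left (norm_nonneg _) hlam.le))
  refine ⟨u, s, μ, σ, min c₁ c₂, lt_min hc₁ hc₂, hu1, hs1, hμ, hσ, fun ω => ?_, fun ω => ?_,
    N, hN, lam, hlam, fun ω => (hdomlt ω).le⟩
  · have := h₁ ω _ (hu ω) _ (hs ω) (hu1 ω) (hs1 ω)
    simp only [hμ, norm_smul, hu1, mul_one] at this
    exact (min_le_left _ _).trans this
  · exact (min_le_right _ _).trans (h₂ ω _ (hu ω) _ (hs ω) (hu1 ω) (hs1 ω))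

theorem DominatedSplitting.exists_dominatedFrame {a : C(Ω, ℂ)} {b : C(Ω, ℝ)} {E : ℂ}
    (hDS : DominatedSplitting T (jacobiCocycle T a b E)) (ω : Ω) :
    ∃ u v s t μ σ : ℤ → ℂ, DominatedFrame (fun n => a ((T ^ n) ω))
      (fun n => E - (b ((T ^ n) ω) : ℂ)) u v s t μ σ := by
  obtain ⟨u, s, μ, σ, c, hc, hu1, hs1, hμ, hσ, hcμ, hcd, N, hN, lam, hlam, hdom⟩ :=
    hDS.exists_frame
  have hT : ∀ n : ℤ, T ((T ^ n) ω) = (T ^ (n + 1)) ω := fun n => by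
    rw [add_comm, zpow_one_add]; rfl
  have hTi : ∀ n : ℤ, T.symm ((T ^ n) ω) = (T ^ (n - 1)) ω := fun n => by
    rw [sub_eq_neg_add, zpow_add, zpow_neg_one]; rfl
  have hTk : ∀ (n : ℤ) (j : ℕ), (T ^ j) ((T ^ n) ω) = (T ^ (n + j)) ω := fun n j => by
    rw [add_comm, zpow_add, zpow_natCast]; rfl
  have hfst : ∀ (w : Ω → EuclideanSpace ℂ (Fin 2)) (ν : Ω → ℂ), (∀ ω,
      Matrix.toEuclideanLin (jacobiCocycle T a b E ω) (w ω) = ν ω • w (T ω)) → ∀ n : ℤ,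
      (E - (b ((T ^ n) ω) : ℂ)) * w ((T ^ n) ω) 0 - conj (a ((T ^ (n - 1)) ω)) * w ((T ^ n) ω) 1
        = ν ((T ^ n) ω) * w ((T ^ (n + 1)) ω) 0 := by
    intro w ν hw n
    have h := congr_arg (fun x : EuclideanSpace ℂ (Fin 2) => x 0) (hw ((T ^ n) ω))
    simpa [jacobiCocycle, Matrix.toLpLin_apply, Matrix.mulVec, dotProduct, Fin.sum_univ_two,
      hT, hTi, ← sub_eq_add_neg] using h
  have hsnd : ∀ (w : Ω → EuclideanSpace ℂ (Fin 2)) (ν : Ω → ℂ), (∀ ω,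
      Matrix.toEuclideanLin (jacobiCocycle T a b E ω) (w ω) = ν ω • w (T ω)) → ∀ n : ℤ,
      a ((T ^ n) ω) * w ((T ^ n) ω) 0 = ν ((T ^ n) ω) * w ((T ^ (n + 1)) ω) 1 := by
    intro w ν hw n
    have h := congr_arg (fun x : EuclideanSpace ℂ (Fin 2) => x 1) (hw ((T ^ n) ω))
    simpa [jacobiCocycle, Matrix.toLpLin_apply, Matrix.mulVec, dotProduct, Fin.sum_univ_two,
      hT, hTi] using h
  have hle : ∀ w : EuclideanSpace ℂ (Fin 2), ‖w‖ = 1 → ∀ i, ‖w i‖ ≤ 1 := fun w hw i =>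
    hw ▸ PiLp.norm_apply_le w i
  refine ⟨fun n => u ((T ^ n) ω) 0, fun n => u ((T ^ n) ω) 1, fun n => s ((T ^ n) ω) 0,
    fun n => s ((T ^ n) ω) 1, fun n => μ ((T ^ n) ω), fun n => σ ((T ^ n) ω),
    hfst u μ hμ, hsnd u μ hμ, hfst s σ hσ, hsnd s σ hσ, fun n => ⟨hle _ (hu1 _) 0,
    hle _ (hu1 _) 1, hle _ (hs1 _) 0, hle _ (hs1 _) 1⟩, ⟨‖a‖, fun n => a.norm_coe_le_norm _⟩,
    ⟨c, hc, fun n => ⟨hcμ _, hcd _⟩⟩, N, hN, lam, hlam, fun n => ?_⟩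
  simpa only [hTk] using hdom ((T ^ n) ω)

end Splitting

end JacobiDS

theorem corollary1p7 {Ω : Type*} [MetricSpace Ω] [CompactSpace Ω] (T : Ω ≃ₜ Ω)
    (a : C(Ω, ℂ)) (b : C(Ω, ℝ)) (E : ℂ)
    (hDS : JacobiDS.DominatedSplitting T (JacobiDS.jacobiCocycle T a b E)) :
    E ∈ ⋂ ω : Ω, resolventSet ℂ (JacobiDS.jacobiOperator T a b ω) := by
  refine Set.mem_iInter.mpr fun ω => ?_
  obtain ⟨u, v, s, t, μ, σ, hframe⟩ := hDS.exists_dominatedFrame ω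
  obtain ⟨C, hC⟩ := hframe.exists_tsum_sq_le
  -- The sign of `C` is unknown; `√C` is nonnegative in any case.
  refine JacobiDS.mem_resolventSet_of_bound (JacobiDS.jacobiOperator_isSelfAdjoint T a b ω) E
    (C := (√C).toNNReal) fun φ => ?_
  set f := (algebraMap ℂ (ℓ²(ℤ, ℂ) →L[ℂ] ℓ²(ℤ, ℂ)) E - JacobiDS.jacobiOperator T a b ω) φ
    with hf
  have hfn : ∀ n, f n = E * φ n - JacobiDS.jacobiOperator T a b ω φ n := fun n => by
    simp only [hf, sub_apply, Algebra.algebraMap_eq_smul_one, smul_apply]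
    rfl
  have hφ := JacobiDS.hasSum_norm_sq φ
  have hfs := JacobiDS.hasSum_norm_sq f
  have hle := hC φ f hφ.summable hfs.summable fun n => by
    rw [hfn, JacobiDS.jacobiOperator_apply]
    ring
  rw [hφ.tsum_eq, hfs.tsum_eq] at hle
  rw [Real.coe_toNNReal _ (Real.sqrt_nonneg _)]
  calc ‖φ‖ = √(‖φ‖ ^ 2) := (Real.sqrt_sq (norm_nonneg _)).symm
    _ ≤ √(C * ‖f‖ ^ 2) := Real.sqrt_le_sqrt hle
    _ = √C * ‖f‖ := by rw [Real.sqrt_mul' _ (by positivity), Real.sqrt_sq (norm_nonneg _)]
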